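/- Let $\mathbb{D}$ be the open unit disc in $\mathbb{C}$, and for $z_1,z_2\in\mathbb{D}$ let $$\mathcal{M}_{\mathbb{D}}(z_1,z_2)=\left|\frac{z_1-z_2}{1-\overline{z_2}\,z_1}\right|$$ be the Möbius distance. For a domain (nonempty connected open set) $\Omega\subseteq\mathbb{C}$ and $p,q\in\Omega$, let $$C_\Omega(p,q)=\sup\{\mathcal{M}_{\mathbb{D}}(f(p),f(q)) : f:\Omega\to\mathbb{D}\text{ holomorphic}\}$$ be the Carathéodory pseudo-distance. Call $\Omega$ Carathéodory hyperbolic if $C_\Omega$ is a distance, that is, if $C_\Omega(p,q)=0$ only when $p=q$. For $n\ge 2$ let $S_n(\Omega)$ be the set of complex $n\times n$ matrices $A$ whose set of eigenvalues $\sigma(A)$ is contained in $\Omega$. **Theorem.** Let $n\ge 2$, let $\Omega\subseteq\mathbb{C}$ be a Carathéodory hyperbolic domain, let $F:\mathbb{D}\to S_n(\Omega)$ be holomorphic, and let $\zeta_1,\zeta_2\in\mathbb{D}$. Put $W_j=F(\zeta_j)$ for $j=1,2$, and for $\lambda\in\sigma(W_j)$ let $m_j(\lambda)$ be the multiplicity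 of $\lambda$ as a zero of the minimal polynomial of $W_j$. Then $$\max\left\{\max_{\mu\in\sigma(W_2)}\prod_{\lambda\in\sigma(W_1)}C_\Omega(\mu,\lambda)^{m_1(\lambda)},\ \max_{\lambda\in\sigma(W_1)}\prod_{\mu\in\sigma(W_2)}C_\Omega(\lambda,\mu)^{m_2(\mu)}\right\}\le\left|\frac{\zeta_1-\zeta_2}{1-\overline{\zeta_2}\,\zeta_1}\right|.$$ -/

import Mathlib

open scoped ComplexConjugate

noncomputable section

/-- The Möbius distance `|(z₁ - z₂) / (1 - conj z₂ * z₁)|` between points of the open unit disc. -/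
def moebiusDist (z₁ z₂ : ℂ) : ℝ :=
  ‖(z₁ - z₂) / (1 - conj z₂ * z₁)‖

/-- The Carathéodory pseudo-distance of `Ω ⊆ ℂ`: the supremum of the Möbius distances of `f p` and
`f q` over all holomorphic maps `f` from `Ω` to the open unit disc. For `p, q ∈ Ω` the set is
nonempty (take `f = 0`) and bounded above by `1`, so that `sSup` is a genuine supremum. -/
def caratheodoryDist (Ω : Set ℂ) (p q : ℂ) : ℝ :=
  sSup {r : ℝ | ∃ f : ℂ → ℂ, DifferentiableOn ℂ f Ω ∧ Set.MapsTo f Ω (Metric.ball 0 1) ∧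
    r = moebiusDist (f p) (f q)}

/-- `Ω` is Carathéodory hyperbolic: its Carathéodory pseudo-distance is a distance on `Ω`. Only
the separation of points is required, as the other axioms of a distance hold for every `Ω`. -/
def IsCaratheodoryHyperbolic (Ω : Set ℂ) : Prop :=
  ∀ p ∈ Ω, ∀ q ∈ Ω, caratheodoryDist Ω p q = 0 → p = q

/-- `S_n(Ω)`: the complex `n × n` matrices all of whose eigenvalues lie in `Ω`. -/
def matricialDomain (n : ℕ) (Ω : Set ℂ) : Set (Matrix (Fin n) (Fin n) ℂ) :=
  {A | spectrum ℂ A ⊆ Ω}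

/-- `F` restricts to a holomorphic map from the open unit disc to the matrix set `S`;
holomorphy of a matrix-valued map is holomorphy of each entry. -/
def IsHolomorphicDiscMap {n : ℕ} (F : ℂ → Matrix (Fin n) (Fin n) ℂ)
    (S : Set (Matrix (Fin n) (Fin n) ℂ)) : Prop :=
  (∀ i j, DifferentiableOn ℂ (fun ζ => F ζ i j) (Metric.ball 0 1)) ∧
    Set.MapsTo F (Metric.ball 0 1) S

/-- The finite set of eigenvalues of a square complex matrix. -/
def eigenvalueFinset {n : ℕ} (A : Matrix (Fin n) (Fin n) ℂ) : Finset ℂ :=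
  (Matrix.finite_spectrum A).toFinset

/-- `∏_{l ∈ σ(A)} C_Ω(z, l) ^ m(l)`, where `m(l)` is the multiplicity of `l` as a zero of the
minimal polynomial of `A`. -/
def caratheodoryProd {n : ℕ} (Ω : Set ℂ) (A : Matrix (Fin n) (Fin n) ℂ) (z : ℂ) : ℝ :=
  ∏ l ∈ eigenvalueFinset A, caratheodoryDist Ω z l ^ (minpoly ℂ A).rootMultiplicity l

/-- A complex matrix of positive size has an eigenvalue. -/
theorem eigenvalueFinset_nonempty {n : ℕ} (hn : 2 ≤ n) (A : Matrix (Fin n) (Fin n) ℂ) :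
    (eigenvalueFinset A).Nonempty := by
  have : Nonempty (Fin n) := ⟨⟨0, by omega⟩⟩
  simpa [eigenvalueFinset] using spectrum.nonempty_of_isAlgClosed_of_finiteDimensional ℂ A

end

/-!
Fix `ζ₁`. For each eigenvalue `l` of `F ζ₁` take a competitor `f l : Ω → 𝔻` in the definition of the
Carathéodory distance, and multiply the functions `discAut (f l l) ∘ f l`, each raised to the
multiplicity `m l` of `l` in the minimal polynomial `q` of `F ζ₁`. The product `h` is holomorphic
on `Ω`, bounded by `1`, and `h = O(q)` near every eigenvalue of `F ζ₁`. The Schwarz lemma for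
eigenvalues, `norm_le_moebiusDist_of_mem_spectrum`, says that `‖h μ‖ ≤ moebiusDist ζ₂ ζ₁` for
every eigenvalue `μ` of `F ζ₂`. Letting each `f l` run through a maximizing sequence turns the
factors of `‖h μ‖` into Carathéodory distances.

For that Schwarz lemma one may assume `ζ₁ = 0`. The power sums `t k ζ = ∑ h(a) ^ k` over the
eigenvalues `a` of `F ζ` (with multiplicity) replace the holomorphic functional calculus:

* `t k` is holomorphic (`differentiableOn_sum_map_charpoly_roots`), since locally it is a sum of
  integrals of `h ^ k * P' / P` over fixed circles, where `P` is the characteristic polynomial of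
  `F ζ`;
* `‖t k‖ ≤ n`, and `t k ζ = O(ζ ^ k)` at `0`: an eigenvalue `a` of `F ζ` satisfies
  `‖h a‖ ≤ C ‖q(a)‖ ≤ C' ‖q(F ζ)‖`, and `q(F ζ)` is differentiable in `ζ` and vanishes at `0`
  (`isBigO_eigenvalues_of_isBigO_minpoly`).

The Schwarz lemma of order `k` gives `‖t k w‖ ≤ n ‖w‖ ^ k` for all `k ≥ 1`, and numbers whose power
sums grow at most like `‖w‖ ^ k` have modulus at most `‖w‖` (`norm_le_of_norm_powerSum_le`).
-/

open Metric Set Filter Topology Polynomial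

/-! ### Power sums -/

/-- Only positive exponents occur in the hypothesis, so that `r = 0` is covered. A polynomial `p` that
vanishes at every other element of `s` gives a fixed linear combination of consecutive power sums
equal to a nonzero multiple of `a ^ (k + 1)`, which is therefore `O(r ^ (k + 1))`. -/
theorem norm_le_of_norm_powerSum_le {s : Multiset ℂ} {C r : ℝ} (hr : 0 ≤ r)
    (h : ∀ k : ℕ, ‖(s.map (fun x => x ^ (k + 1))).sum‖ ≤ C * r ^ (k + 1)) {a : ℂ} (ha : a ∈ s) :
    ‖a‖ ≤ r := by
  classical
  set p : ℂ[X] := ∏ c ∈ s.toFinset.erase a, (X - Polynomial.C c) with hp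
  have hpa : p.eval a ≠ 0 := by
    rw [hp, eval_prod, Finset.prod_ne_zero_iff]
    intro c hc
    simpa [sub_eq_zero] using (Finset.ne_of_mem_erase hc).symm
  have hp0 : ∀ c ∈ s.toFinset, c ≠ a → p.eval c = 0 := by
    intro c hc hca
    rw [hp, eval_prod]
    exact Finset.prod_eq_zero (Finset.mem_erase.2 ⟨hca, hc⟩) (by simp)
  have hcount : (s.count a : ℂ) ≠ 0 := by
    simpa [Multiset.count_eq_zero] using ha
  have key : ∀ k : ℕ, (s.count a : ℂ) * (p.eval a * a ^ (k + 1)) =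
      ∑ j ∈ Finset.range (p.natDegree + 1),
        p.coeff j * (s.map (fun x => x ^ (k + j + 1))).sum := by
    intro k
    -- weighting by `p` removes every element of `s` other than `a`
    have h1 : (s.map (fun x => p.eval x * x ^ (k + 1))).sum =
        (s.count a : ℂ) * (p.eval a * a ^ (k + 1)) := by
      rw [Finset.sum_multiset_map_count, Finset.sum_eq_single_of_mem a (by simpa using ha)]
      · simp
      · intro b hb hba
        simp [hp0 b hb hba]
    rw [← h1]
    simp_rw [← Multiset.sum_map_mul_left]
    rw [← Multiset.sum_map_sum]
    congr 1
    refine Multiset.map_congr rfl fun x _ => ?_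
    rw [eval_eq_sum_range, Finset.sum_mul]
    refine Finset.sum_congr rfl fun j _ => ?_
    ring
  by_contra! hlt
  have hapos : 0 < ‖a‖ := hr.trans_lt hlt
  set K : ℝ := ∑ j ∈ Finset.range (p.natDegree + 1), ‖p.coeff j‖ * (C * r ^ j) with hK
  have hbound : ∀ k : ℕ, ‖(s.count a : ℂ) * p.eval a‖ ≤ K * (r / ‖a‖) ^ (k + 1) := by
    intro k
    have : ‖(s.count a : ℂ) * p.eval a‖ * ‖a‖ ^ (k + 1) ≤ K * r ^ (k + 1) := by
      rw [← norm_pow, ← norm_mul, mul_assoc, key k, hK, Finset.sum_mul]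
      refine (norm_sum_le _ _).trans (Finset.sum_le_sum fun j _ => ?_)
      rw [norm_mul]
      calc _ ≤ ‖p.coeff j‖ * (C * r ^ (k + j + 1)) := by gcongr; exact h _
        _ = _ := by ring
    rw [div_pow, ← mul_div_assoc, le_div_iff₀ (by positivity)]
    exact this
  have hlim : Tendsto (fun k : ℕ => K * (r / ‖a‖) ^ (k + 1)) atTop (𝓝 (K * 0)) :=
    ((tendsto_pow_atTop_nhds_zero_of_lt_one (by positivity)
      ((div_lt_one hapos).2 hlt)).comp (tendsto_add_atTop_nat 1)).const_mul K
  have := ge_of_tendsto' hlim hbound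
  rw [mul_zero] at this
  exact mul_ne_zero hcount hpa (norm_le_zero_iff.1 this)

/-! ### Circle integrals depending on a parameter -/

theorem differentiableOn_circleIntegral {V : Set ℂ} (hV : IsOpen V) {G : ℂ → ℂ → ℂ} {c : ℂ}
    {r : ℝ} (hr : 0 ≤ r) (hd : ∀ z ∈ sphere c r, DifferentiableOn ℂ (fun ζ => G ζ z) V)
    (hc : ContinuousOn (Function.uncurry G) (V ×ˢ sphere c r)) :
    DifferentiableOn ℂ (fun ζ => ∮ z in C(c, r), G ζ z) V := by
  intro ζ₀ hζ₀
  refine DifferentiableAt.differentiableWithinAt ?_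
  obtain ⟨ε, hε, hεV⟩ := nhds_basis_closedBall.mem_iff.1 (hV.mem_nhds hζ₀)
  obtain ⟨M, hM⟩ := ((isCompact_closedBall ζ₀ ε).prod
    (isCompact_sphere c r)).exists_bound_of_continuousOn (hc.mono (prod_mono hεV subset_rfl))
  have hsph : ∀ θ : ℝ, circleMap c r θ ∈ sphere c r := circleMap_mem_sphere c hr
  have hcont : ∀ ζ ∈ V,
      Continuous fun θ : ℝ => deriv (circleMap c r) θ • G ζ (circleMap c r θ) := by
    intro ζ hζ
    have h1 : Continuous fun θ : ℝ => G ζ (circleMap c r θ) :=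
      hc.comp_continuous (f := fun θ : ℝ => (ζ, circleMap c r θ)) (by fun_prop)
        fun θ => ⟨hζ, hsph θ⟩
    simp only [deriv_circleMap]
    exact ((continuous_circleMap 0 r).mul continuous_const).smul h1
  have hdat : ∀ θ : ℝ, ∀ ζ ∈ V, HasDerivAt
      (fun ζ => deriv (circleMap c r) θ • G ζ (circleMap c r θ))
      (deriv (circleMap c r) θ • deriv (fun ζ => G ζ (circleMap c r θ)) ζ) ζ := fun θ ζ hζ =>
    ((hd _ (hsph θ)).differentiableAt (hV.mem_nhds hζ)).hasDerivAt.fun_const_smul _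
  -- Cauchy's estimate on discs of radius `ε / 2` bounds the derivative in the parameter uniformly.
  refine (intervalIntegral.hasDerivAt_integral_of_dominated_loc_of_deriv_le
    (F := fun ζ θ => deriv (circleMap c r) θ • G ζ (circleMap c r θ))
    (F' := fun ζ θ => deriv (circleMap c r) θ • deriv (fun ζ => G ζ (circleMap c r θ)) ζ)
    (bound := fun _ => r * (M / (ε / 2)))
    (ball_mem_nhds ζ₀ (half_pos hε)) ?_ ?_ ?_ ?_ ?_ ?_).2.differentiableAt
  · filter_upwards [hV.mem_nhds hζ₀] with ζ hζ
    exact (hcont ζ hζ).aestronglyMeasurable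
  · exact (hcont ζ₀ hζ₀).intervalIntegrable _ _
  · -- the derivative is a pointwise limit of difference quotients, which are continuous in `θ`
    have hmem : ∀ n : ℕ, ζ₀ + (ε / (n + 1 : ℝ) : ℝ) ∈ V := fun n => hεV <| by
      rw [mem_closedBall, dist_eq_norm, add_sub_cancel_left, Complex.norm_real, Real.norm_eq_abs,
        abs_of_nonneg (by positivity)]
      exact div_le_self hε.le (by linarith [n.cast_nonneg (α := ℝ)])
    refine aestronglyMeasurable_of_tendsto_ae (u := atTop)
      (f := fun (n : ℕ) θ => slope (fun ζ => deriv (circleMap c r) θ • G ζ (circleMap c r θ)) ζ₀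
        (ζ₀ + (ε / (n + 1 : ℝ) : ℝ))) (fun n => ?_) (MeasureTheory.ae_of_all _ fun θ => ?_)
    · simp only [slope_def_module]
      exact (((hcont _ (hmem n)).fun_sub (hcont _ hζ₀)).fun_const_smul _).aestronglyMeasurable
    · refine (hasDerivAt_iff_tendsto_slope.1 (hdat θ ζ₀ hζ₀)).comp
        (tendsto_nhdsWithin_iff.2 ⟨?_, .of_forall fun n => ?_⟩)
      · have h0 : Tendsto (fun n : ℕ => ε / (n + 1 : ℝ)) atTop (𝓝 0) := by
          simpa [div_eq_mul_inv] using (tendsto_one_div_add_atTop_nhds_zero_nat (𝕜 := ℝ)).const_mul ε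
        simpa using ((Complex.continuous_ofReal.tendsto 0).comp h0).const_add ζ₀
      · have : (ε / (n + 1 : ℝ) : ℝ) ≠ 0 := by positivity
        simpa only [mem_compl_iff, mem_singleton_iff, add_eq_left, Complex.ofReal_eq_zero] using this
  · refine MeasureTheory.ae_of_all _ fun θ _ ζ hζ => ?_
    rw [norm_smul, deriv_circleMap, norm_mul, Complex.norm_I, mul_one, norm_circleMap_zero,
      abs_of_nonneg hr]
    gcongr
    refine Complex.norm_deriv_le_of_forall_mem_sphere_norm_le (half_pos hε) ?_ fun w hw => ?_
    · refine ((hd _ (hsph θ)).mono ?_).diffContOnCl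
      rw [closure_ball _ (half_pos hε).ne']
      exact (closedBall_subset_closedBall' (by rw [mem_ball] at hζ; linarith)).trans hεV
    · refine hM (w, circleMap c r θ) ⟨?_, hsph θ⟩
      exact closedBall_subset_closedBall' (ε₁ := ε / 2) (x := ζ)
        (by rw [mem_ball] at hζ; linarith) (sphere_subset_closedBall hw)
  · exact intervalIntegrable_const
  · refine MeasureTheory.ae_of_all _ fun θ _ ζ hζ => hdat θ ζ (hεV ?_)
    exact closedBall_subset_closedBall (half_le_self hε.le) (ball_subset_closedBall hζ)

/-! ### Sums over the roots of a polynomial -/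

/-- Cauchy's integral formula, applied to each of the poles `a ∈ s`; a pole outside the disc
contributes `0`. -/
theorem circleIntegral_mul_sum_one_div {g : ℂ → ℂ} {c : ℂ} {r : ℝ} (hr : 0 < r)
    (hg : DifferentiableOn ℂ g (closedBall c r)) [DecidablePred (· ∈ ball c r)]
    (s : Multiset ℂ) (hs : ∀ a ∈ s, a ∉ sphere c r) :
    CircleIntegrable (fun z => g z * (s.map fun a => 1 / (z - a)).sum) c r ∧
    ∮ z in C(c, r), g z * (s.map fun a => 1 / (z - a)).sum =
      2 * Real.pi * Complex.I * (s.map fun a => if a ∈ ball c r then g a else 0).sum := by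
  induction s using Multiset.induction_on with
  | empty => simp [circleIntegral]
  | cons a s ih =>
    obtain ⟨h1, h2⟩ := ih fun b hb => hs b (Multiset.mem_cons_of_mem hb)
    have ha := hs a (Multiset.mem_cons_self a s)
    have hint : CircleIntegrable (fun z => (z - a)⁻¹ • g z) c r := by
      refine ContinuousOn.circleIntegrable hr.le ?_
      refine ContinuousOn.smul
        (ContinuousOn.inv₀ (f := fun z => z - a) (by fun_prop) fun z hz hza => ?_)
        (hg.continuousOn.mono sphere_subset_closedBall)
      rw [sub_eq_zero] at hza
      exact ha (hza ▸ hz)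
    have hval : ∮ z in C(c, r), (z - a)⁻¹ • g z =
        2 * Real.pi * Complex.I * (if a ∈ ball c r then g a else 0) := by
      split_ifs with hab
      · rw [hg.circleIntegral_sub_inv_smul hab, smul_eq_mul]
      · rw [mul_zero]
        have hac : ∀ z ∈ closedBall c r, z - a ≠ 0 := by
          intro z hz hza
          rw [sub_eq_zero] at hza
          rw [← ball_union_sphere, hza] at hz
          exact hz.elim hab ha
        have hd : DifferentiableOn ℂ (fun z => (z - a)⁻¹ • g z) (closedBall c r) :=
          (DifferentiableOn.fun_inv (by fun_prop) hac).smul hg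
        rw [← closure_ball c hr.ne'] at hd
        exact hd.diffContOnCl.circleIntegral_eq_zero hr.le
    have heq : (fun z => g z * ((a ::ₘ s).map fun a => 1 / (z - a)).sum) =
        fun z => (z - a)⁻¹ • g z + g z * (s.map fun a => 1 / (z - a)).sum := by
      funext z
      simp only [Multiset.map_cons, Multiset.sum_cons, smul_eq_mul]
      ring
    rw [heq]
    refine ⟨hint.add h1, ?_⟩
    rw [circleIntegral.integral_add hint h1, hval, h2, Multiset.map_cons, Multiset.sum_cons]
    ring

/-- The logarithmic derivative `P' / P` has residue `1` at each root, counted with multiplicity, so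
the argument principle weighted by `g` computes the sum of `g` over the roots. -/
theorem sum_map_roots_eq_circleIntegral {P : ℂ[X]} {S : Finset ℂ} {r : ℝ} (hr : 0 < r)
    (hdisj : ∀ a ∈ S, ∀ b ∈ S, a ≠ b → Disjoint (closedBall a r) (closedBall b r)) {g : ℂ → ℂ}
    (hg : ∀ c ∈ S, DifferentiableOn ℂ g (closedBall c r)) (hP : P ≠ 0)
    (hroots : ∀ a ∈ P.roots, ∃ c ∈ S, a ∈ ball c r) :
    (P.roots.map g).sum = ∑ c ∈ S, (2 * Real.pi * Complex.I)⁻¹ *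
      ∮ z in C(c, r), g z * (P.derivative.eval z / P.eval z) := by
  classical
  have hsph : ∀ c ∈ S, ∀ a ∈ P.roots, a ∉ sphere c r := by
    intro c hc a ha hac
    obtain ⟨b, hb, hab⟩ := hroots a ha
    rcases eq_or_ne b c with rfl | hbc
    · rw [mem_sphere] at hac
      rw [mem_ball] at hab
      exact hab.ne hac
    · exact disjoint_left.1 (hdisj b hb c hc hbc) (ball_subset_closedBall hab)
        (sphere_subset_closedBall hac)
  have hI : (2 * Real.pi * Complex.I : ℂ) ≠ 0 := Complex.two_pi_I_ne_zero
  have h1 : ∀ c ∈ S, (2 * Real.pi * Complex.I : ℂ)⁻¹ *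
      ∮ z in C(c, r), g z * (P.derivative.eval z / P.eval z) =
      (P.roots.map fun a => if a ∈ ball c r then g a else 0).sum := by
    intro c hc
    rw [inv_mul_eq_iff_eq_mul₀ hI, ← (circleIntegral_mul_sum_one_div hr (hg c hc) P.roots
      (hsph c hc)).2]
    refine circleIntegral.integral_congr hr.le fun z hz => ?_
    have hz0 : P.eval z ≠ 0 := fun h0 => hsph c hc z ((mem_roots hP).2 h0) hz
    simp only [(IsAlgClosed.splits P).eval_derivative_div_eval_of_ne_zero hz0]
  rw [Finset.sum_congr rfl h1, ← Multiset.sum_map_sum]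
  congr 1
  refine Multiset.map_congr rfl fun a ha => ?_
  obtain ⟨b, hb, hab⟩ := hroots a ha
  rw [Finset.sum_eq_single_of_mem b hb, if_pos hab]
  intro c hc hcb
  rw [if_neg]
  exact fun hac => disjoint_left.1 (hdisj b hb c hc hcb.symm) (ball_subset_closedBall hab)
    (ball_subset_closedBall hac)

/-! ### Sums over the eigenvalues of a holomorphic matrix family -/

section Eigenvalues

open scoped Matrix.Norms.Operator

variable {n : ℕ} {V : Set ℂ} {F : ℂ → Matrix (Fin n) (Fin n) ℂ}

theorem differentiableOn_matrix (hF : ∀ i j, DifferentiableOn ℂ (fun ζ => F ζ i j) V) :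
    DifferentiableOn ℂ F V := by
  have h : F = fun ζ => ∑ i, ∑ j, F ζ i j • Matrix.single i j (1 : ℂ) := by
    funext ζ
    simpa [Matrix.smul_single] using Matrix.matrix_eq_sum_single (F ζ)
  rw [h]
  exact DifferentiableOn.fun_sum fun i _ => DifferentiableOn.fun_sum fun j _ =>
    (hF i j).smul_const _

theorem differentiableOn_charpoly_coeff (hF : ∀ i j, DifferentiableOn ℂ (fun ζ => F ζ i j) V)
    (k : ℕ) : DifferentiableOn ℂ (fun ζ => (F ζ).charpoly.coeff k) V := by
  -- The coefficients are universal polynomials in the matrix entries.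
  have key : ∀ p : MvPolynomial (Fin n × Fin n) ℂ, DifferentiableOn ℂ
      (fun ζ => MvPolynomial.eval₂Hom (RingHom.id ℂ) (fun ij => F ζ ij.1 ij.2) p) V := by
    intro p
    induction p using MvPolynomial.induction_on with
    | C a => simp
    | add p q hp hq => simpa only [map_add] using hp.fun_add hq
    | mul_X p ij hp => simpa only [map_mul, MvPolynomial.eval₂Hom_X'] using hp.fun_mul (hF ij.1 ij.2)
  refine (key ((Matrix.charpoly.univ ℂ (Fin n)).coeff k)).congr fun ζ _ => ?_
  rw [Matrix.charpoly.univ_coeff_eval₂Hom]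
  rfl

/-- Eigenvalues depend upper semicontinuously on the matrix. -/
theorem eventually_spectrum_subset {ζ₀ : ℂ} (hF : ContinuousAt F ζ₀) {U : Set ℂ} (hU : IsOpen U)
    (h : spectrum ℂ (F ζ₀) ⊆ U) : ∀ᶠ ζ in 𝓝 ζ₀, spectrum ℂ (F ζ) ⊆ U := by
  have h1 := upperHemicontinuousAt_iff.1
    (upperHemicontinuous_iff.1 (upperHemicontinuous_spectrum ℂ (Matrix (Fin n) (Fin n) ℂ)) (F ζ₀))
    U (hU.mem_nhdsSet.2 h)
  filter_upwards [hF.eventually h1] with ζ hζ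
  exact hU.mem_nhdsSet.1 hζ

theorem mem_charpoly_roots_iff {A : Matrix (Fin n) (Fin n) ℂ} {a : ℂ} :
    a ∈ A.charpoly.roots ↔ a ∈ spectrum ℂ A := by
  rw [mem_roots A.charpoly_monic.ne_zero, Matrix.mem_spectrum_iff_isRoot_charpoly]

theorem card_charpoly_roots (A : Matrix (Fin n) (Fin n) ℂ) : A.charpoly.roots.card = n := by
  rw [← (IsAlgClosed.splits A.charpoly).natDegree_eq_card_roots, A.charpoly_natDegree_eq_dim,
    Fintype.card_fin]

theorem exists_radius_of_finset_subset {Ω : Set ℂ} (hΩ : IsOpen Ω) (S : Finset ℂ)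
    (hS : ∀ c ∈ S, c ∈ Ω) : ∃ r > 0, (∀ c ∈ S, closedBall c r ⊆ Ω) ∧
      ∀ a ∈ S, ∀ b ∈ S, a ≠ b → Disjoint (closedBall a r) (closedBall b r) := by
  have h1 : ∀ᶠ r in 𝓝[>] (0 : ℝ), ∀ c ∈ S, closedBall c r ⊆ Ω := by
    refine (Finset.eventually_all S).2 fun c hc => ?_
    obtain ⟨ε, hε, h⟩ := nhds_basis_closedBall.mem_iff.1 (hΩ.mem_nhds (hS c hc))
    filter_upwards [Ioo_mem_nhdsGT hε] with r hr
    exact (closedBall_subset_closedBall hr.2.le).trans h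
  have h2 : ∀ᶠ r in 𝓝[>] (0 : ℝ), ∀ a ∈ S, ∀ b ∈ S, a ≠ b →
      Disjoint (closedBall a r) (closedBall b r) := by
    refine (Finset.eventually_all S).2 fun a _ => (Finset.eventually_all S).2 fun b _ => ?_
    rcases eq_or_ne a b with rfl | hab
    · simp
    · filter_upwards [Ioo_mem_nhdsGT (half_pos (dist_pos.2 hab))] with r hr _
      exact closedBall_disjoint_closedBall (by linarith [hr.2])
  obtain ⟨r, ⟨ha, hb⟩, hr⟩ := ((h1.and h2).and self_mem_nhdsWithin).exists
  exact ⟨r, hr, ha, hb⟩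

/-- The eigenvalues themselves need not be holomorphic in `ζ`, nor even admit a continuous global
choice, but symmetric sums over them are holomorphic: near `ζ₀` they are integrals over fixed
circles around the eigenvalues of `F ζ₀`. -/
theorem differentiableOn_sum_map_charpoly_roots (hV : IsOpen V)
    (hF : ∀ i j, DifferentiableOn ℂ (fun ζ => F ζ i j) V) {Ω : Set ℂ} (hΩ : IsOpen Ω)
    (hFΩ : ∀ ζ ∈ V, spectrum ℂ (F ζ) ⊆ Ω) {g : ℂ → ℂ} (hg : DifferentiableOn ℂ g Ω) :
    DifferentiableOn ℂ (fun ζ => ((F ζ).charpoly.roots.map g).sum) V := by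
  intro ζ₀ hζ₀
  set S : Finset ℂ := (F ζ₀).charpoly.roots.toFinset
  have hS : ∀ c, c ∈ S ↔ c ∈ spectrum ℂ (F ζ₀) := fun c => by
    rw [Multiset.mem_toFinset, mem_charpoly_roots_iff]
  obtain ⟨r, hr, hrΩ, hdisj⟩ := exists_radius_of_finset_subset hΩ S
    fun c hc => hFΩ ζ₀ hζ₀ ((hS c).1 hc)
  set U : Set ℂ := ⋃ c ∈ S, ball c r with hU
  have hUo : IsOpen U := isOpen_biUnion fun _ _ => isOpen_ball
  have hev : ∀ᶠ ζ in 𝓝 ζ₀, ζ ∈ V ∧ spectrum ℂ (F ζ) ⊆ U :=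
    (hV.eventually_mem hζ₀).and (eventually_spectrum_subset
      ((differentiableOn_matrix hF).continuousOn.continuousAt (hV.mem_nhds hζ₀)) hUo
      fun c hc => mem_biUnion ((hS c).2 hc) (mem_ball_self hr))
  obtain ⟨W, hW, hWo, hζ₀W⟩ := _root_.eventually_nhds_iff.1 hev
  have hroots : ∀ ζ ∈ W, ∀ a ∈ (F ζ).charpoly.roots, ∃ c ∈ S, a ∈ ball c r := fun ζ hζ a ha => by
    simpa [hU] using (hW ζ hζ).2 (mem_charpoly_roots_iff.1 ha)
  -- No eigenvalue reaches the circles of integration, as these lie outside all the open discs.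
  have hne : ∀ c ∈ S, ∀ ζ ∈ W, ∀ z ∈ sphere c r, (F ζ).charpoly.eval z ≠ 0 := by
    intro c hc ζ hζ z hz h0
    obtain ⟨b, hb, hzb⟩ := hroots ζ hζ z ((mem_roots (F ζ).charpoly_monic.ne_zero).2 h0)
    rcases eq_or_ne b c with rfl | hbc
    · exact (mem_ball.1 hzb).ne (mem_sphere.1 hz)
    · exact disjoint_left.1 (hdisj b hb c hc hbc) (ball_subset_closedBall hzb)
        (sphere_subset_closedBall hz)
  have hcoef : ∀ k, DifferentiableOn ℂ (fun ζ => (F ζ).charpoly.coeff k) W := fun k =>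
    (differentiableOn_charpoly_coeff hF k).mono fun ζ hζ => (hW ζ hζ).1
  have hdeg : ∀ ζ, (F ζ).charpoly.natDegree < n + 1 := fun ζ => by
    rw [(F ζ).charpoly_natDegree_eq_dim, Fintype.card_fin]; omega
  have hD : ∀ ζ z, (F ζ).charpoly.eval z =
      ∑ k ∈ Finset.range (n + 1), (F ζ).charpoly.coeff k * z ^ k := fun ζ z =>
    eval_eq_sum_range' (hdeg ζ) z
  have hN : ∀ ζ z, (F ζ).charpoly.derivative.eval z =
      ∑ k ∈ Finset.range (n + 1), (F ζ).charpoly.coeff (k + 1) * (k + 1) * z ^ k := fun ζ z => by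
    rw [eval_eq_sum_range' ((natDegree_derivative_le _).trans_lt
      ((Nat.sub_le _ _).trans_lt (hdeg ζ)))]
    simp only [coeff_derivative]
  have hrep : ∀ ζ ∈ W, ((F ζ).charpoly.roots.map g).sum =
      ∑ c ∈ S, (2 * Real.pi * Complex.I)⁻¹ *
        ∮ z in C(c, r), g z * ((F ζ).charpoly.derivative.eval z / (F ζ).charpoly.eval z) :=
    fun ζ hζ => sum_map_roots_eq_circleIntegral hr hdisj (fun c hc => hg.mono (hrΩ c hc))
      (F ζ).charpoly_monic.ne_zero (hroots ζ hζ)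
  refine DifferentiableAt.differentiableWithinAt
    (((DifferentiableOn.fun_sum fun c hc => ?_).congr hrep).differentiableAt (hWo.mem_nhds hζ₀W))
  refine DifferentiableOn.const_mul (differentiableOn_circleIntegral hWo hr.le ?_ ?_) _
  · intro z hz
    refine DifferentiableOn.const_mul (DifferentiableOn.fun_div ?_ ?_ fun ζ hζ => hne c hc ζ hζ z hz) _
    · simp only [hN]
      exact DifferentiableOn.fun_sum fun k _ => ((hcoef _).mul_const _).mul_const _
    · simp only [hD]
      exact DifferentiableOn.fun_sum fun k _ => (hcoef _).mul_const _
  · have hcc : ∀ k, ContinuousOn (fun p : ℂ × ℂ => (F p.1).charpoly.coeff k) (W ×ˢ sphere c r) :=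
      fun k => (hcoef k).continuousOn.comp continuousOn_fst fun p hp => hp.1
    refine ContinuousOn.mul ?_ (ContinuousOn.div₀ ?_ ?_ fun p hp => hne c hc p.1 hp.1 p.2 hp.2)
    · exact (hg.continuousOn.mono (hrΩ c hc)).comp continuousOn_snd
        fun p hp => sphere_subset_closedBall hp.2
    · simp only [hN]
      exact continuousOn_finsetSum _ fun k _ =>
        ((hcc _).mul continuousOn_const).mul (continuousOn_snd.pow k)
    · simp only [hD]
      exact continuousOn_finsetSum _ fun k _ => (hcc _).mul (continuousOn_snd.pow k)

/-- The minimal polynomial `q` of `F ζ₀` (rather than the characteristic polynomial) suffices here,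
because `q(a)` is an eigenvalue of `q(F ζ)`, which is `O(ζ - ζ₀)`. -/
theorem isBigO_eigenvalues_of_isBigO_minpoly {h : ℂ → ℂ} {ζ₀ : ℂ} (hF : DifferentiableAt ℂ F ζ₀)
    (hh : ∀ l ∈ spectrum ℂ (F ζ₀), h =O[𝓝 l] fun z => (minpoly ℂ (F ζ₀)).eval z) :
    ∃ C, ∀ᶠ ζ in 𝓝 ζ₀, ∀ a ∈ spectrum ℂ (F ζ), ‖h a‖ ≤ C * ‖ζ - ζ₀‖ := by
  set q := minpoly ℂ (F ζ₀) with hq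
  set S : Finset ℂ := (Matrix.finite_spectrum (F ζ₀)).toFinset
  have hS : ∀ c, c ∈ S ↔ c ∈ spectrum ℂ (F ζ₀) := fun c => by simp [S]
  obtain ⟨K, hK0, hK⟩ : ∃ K : ℝ, 0 ≤ K ∧ ∀ l ∈ S, ∀ᶠ z in 𝓝 l, ‖h z‖ ≤ K * ‖q.eval z‖ := by
    choose! K hK using fun l hl => (hh l hl).bound
    refine ⟨∑ l ∈ S, |K l|, Finset.sum_nonneg fun _ _ => abs_nonneg _, fun l hl => ?_⟩
    filter_upwards [hK l ((hS l).1 hl)] with z hz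
    refine hz.trans (mul_le_mul_of_nonneg_right ((le_abs_self _).trans ?_) (norm_nonneg _))
    exact Finset.single_le_sum (f := fun l => |K l|) (fun _ _ => abs_nonneg _) hl
  choose! U hU hUo hUl using fun l hl => _root_.eventually_nhds_iff.1 (hK l hl)
  have hsub : ∀ᶠ ζ in 𝓝 ζ₀, spectrum ℂ (F ζ) ⊆ ⋃ l ∈ S, U l :=
    eventually_spectrum_subset hF.continuousAt (isOpen_biUnion fun l hl => hUo l hl)
      fun l hl => mem_biUnion ((hS l).2 hl) (hUl l ((hS l).2 hl))
  have hqF : DifferentiableAt ℂ (fun ζ => aeval (F ζ) q) ζ₀ := by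
    simp only [aeval_eq_sum_range]
    exact DifferentiableAt.fun_sum fun k _ => (hF.fun_pow k).fun_const_smul _
  obtain ⟨C, hC⟩ := hqF.isBigO_sub.bound
  refine ⟨K * (C * ‖(1 : Matrix (Fin n) (Fin n) ℂ)‖), ?_⟩
  filter_upwards [hsub, hC] with ζ h1 h2 a ha
  obtain ⟨l, hl, hal⟩ := mem_iUnion₂.1 (h1 ha)
  rw [hq, minpoly.aeval, sub_zero, ← hq] at h2
  have h3 : q.eval a ∈ spectrum ℂ (aeval (F ζ) q) :=
    spectrum.subset_polynomial_aeval (F ζ) q ⟨a, ha, rfl⟩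
  calc ‖h a‖ ≤ K * ‖q.eval a‖ := hU l hl a hal
    _ ≤ K * (‖aeval (F ζ) q‖ * ‖(1 : Matrix (Fin n) (Fin n) ℂ)‖) := by
      gcongr; exact spectrum.norm_le_norm_mul_of_mem h3
    _ ≤ K * (C * ‖ζ - ζ₀‖ * ‖(1 : Matrix (Fin n) (Fin n) ℂ)‖) := by gcongr
    _ = _ := by ring

/-- The Schwarz lemma for the eigenvalues, centred at `0`: the case `ζ₁ = 0` of
`norm_le_moebiusDist_of_mem_spectrum`. -/
theorem norm_le_norm_of_mem_spectrum (hF : ∀ i j, DifferentiableOn ℂ (fun ζ => F ζ i j) (ball 0 1))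
    {Ω : Set ℂ} (hΩ : IsOpen Ω) (hFΩ : ∀ ζ ∈ ball (0 : ℂ) 1, spectrum ℂ (F ζ) ⊆ Ω) {h : ℂ → ℂ}
    (hd : DifferentiableOn ℂ h Ω) (hb : ∀ z ∈ Ω, ‖h z‖ ≤ 1)
    (hh : ∀ l ∈ spectrum ℂ (F 0), h =O[𝓝 l] fun z => (minpoly ℂ (F 0)).eval z)
    {w : ℂ} (hw : w ∈ ball (0 : ℂ) 1) {a : ℂ} (ha : a ∈ spectrum ℂ (F w)) : ‖h a‖ ≤ ‖w‖ := by
  have h0 : (0 : ℂ) ∈ ball (0 : ℂ) 1 := mem_ball_self one_pos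
  have hsum : ∀ ζ (M : ℝ), (∀ a ∈ spectrum ℂ (F ζ), ‖h a‖ ≤ M) → 0 ≤ M → ∀ k : ℕ,
      ‖((F ζ).charpoly.roots.map fun a => h a ^ k).sum‖ ≤ n * M ^ k := by
    intro ζ M hM hM0 k
    refine (Multiset.le_sum_of_subadditive _ norm_zero.le norm_add_le _).trans ?_
    refine (Multiset.sum_le_card_nsmul _ (M ^ k) ?_).trans_eq ?_
    · simp only [Multiset.mem_map]
      rintro _ ⟨_, ⟨a, ha, rfl⟩, rfl⟩
      rw [norm_pow]
      exact pow_le_pow_left₀ (norm_nonneg _) (hM a (mem_charpoly_roots_iff.1 ha)) k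
    · simp [card_charpoly_roots]
  obtain ⟨C, hC⟩ := isBigO_eigenvalues_of_isBigO_minpoly
    ((differentiableOn_matrix hF).differentiableAt (isOpen_ball.mem_nhds h0)) hh
  simp only [sub_zero] at hC
  refine norm_le_of_norm_powerSum_le (s := (F w).charpoly.roots.map h) (C := n) (norm_nonneg w)
    (fun k => ?_) (Multiset.mem_map_of_mem h (mem_charpoly_roots_iff.2 ha))
  rw [Multiset.map_map]
  set t : ℂ → ℂ := fun ζ => ((F ζ).charpoly.roots.map fun a => h a ^ (k + 1)).sum with ht
  have htO : t =O[𝓝 0] fun ζ => ζ ^ (k + 1) := by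
    refine Asymptotics.IsBigO.of_bound (n * |C| ^ (k + 1)) ?_
    filter_upwards [hC] with ζ hζ
    have := hsum ζ (|C| * ‖ζ‖) (fun a ha => (hζ a ha).trans
      (mul_le_mul_of_nonneg_right (le_abs_self C) (norm_nonneg ζ))) (by positivity) (k + 1)
    rwa [mul_pow, ← mul_assoc, ← norm_pow] at this
  have ht0 : t 0 = 0 := by
    have := htO.eq_zero_imp.self_of_nhds
    exact this (by simp)
  have hlo : (fun ζ => t ζ - t 0) =o[𝓝 0] fun ζ => ‖ζ - 0‖ ^ k := by
    simp only [ht0, sub_zero]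
    refine htO.trans_isLittleO ?_
    simpa only [← norm_pow] using (Asymptotics.isLittleO_pow_pow (𝕜 := ℂ) k.lt_succ_self).norm_right
  have := Complex.dist_le_mul_div_pow_of_mapsTo_ball_of_isLittleO (f := t) (R₂ := n)
    (differentiableOn_sum_map_charpoly_roots isOpen_ball hF hΩ hFΩ (hd.fun_pow (k + 1)))
    (fun ζ hζ => by
      rw [ht0, mem_closedBall_zero_iff]
      simpa using hsum ζ 1 (fun a ha => hb a (hFΩ ζ hζ ha)) zero_le_one (k + 1)) hlo hw
  rw [ht0, dist_zero_right, dist_zero_right, div_one] at this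
  exact this

end Eigenvalues

/-! ### Automorphisms of the unit disc -/

/-- The automorphism `z ↦ (z - a) / (1 - conj a * z)` of the unit disc that takes `a` to `0`. -/
noncomputable def discAut (a z : ℂ) : ℂ := (z - a) / (1 - conj a * z)

theorem moebiusDist_eq_norm_discAut (z a : ℂ) : moebiusDist z a = ‖discAut a z‖ := rfl

theorem one_sub_conj_mul_ne_zero {a z : ℂ} (ha : ‖a‖ < 1) (hz : ‖z‖ < 1) :
    1 - conj a * z ≠ 0 := by
  intro h
  have h1 : ‖conj a * z‖ = 1 := by rw [← sub_eq_zero.1 h, norm_one]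
  rw [norm_mul, RCLike.norm_conj] at h1
  nlinarith [norm_nonneg a, norm_nonneg z]

theorem norm_discAut_lt_one {a z : ℂ} (ha : ‖a‖ < 1) (hz : ‖z‖ < 1) : ‖discAut a z‖ < 1 := by
  rw [discAut, norm_div, div_lt_one (norm_pos_iff.2 (one_sub_conj_mul_ne_zero ha hz))]
  have h : ‖1 - conj a * z‖ ^ 2 - ‖z - a‖ ^ 2 = (1 - ‖a‖ ^ 2) * (1 - ‖z‖ ^ 2) := by
    simp only [← Complex.normSq_eq_norm_sq, Complex.normSq_apply, Complex.sub_re, Complex.sub_im,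
      Complex.mul_re, Complex.mul_im, Complex.conj_re, Complex.conj_im, Complex.one_re,
      Complex.one_im]
    ring
  have h1 : 0 < (1 - ‖a‖ ^ 2) * (1 - ‖z‖ ^ 2) := by
    apply mul_pos <;> nlinarith [norm_nonneg a, norm_nonneg z]
  exact lt_of_pow_lt_pow_left₀ 2 (norm_nonneg _) (by linarith)

theorem differentiableOn_discAut {a : ℂ} (ha : ‖a‖ < 1) :
    DifferentiableOn ℂ (discAut a) (ball 0 1) :=
  DifferentiableOn.fun_div (by fun_prop) (by fun_prop) fun _ hz =>
    one_sub_conj_mul_ne_zero ha (mem_ball_zero_iff.1 hz)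

theorem discAut_neg_discAut {a z : ℂ} (ha : ‖a‖ < 1) (hz : ‖z‖ < 1) :
    discAut (-a) (discAut a z) = z := by
  have h1 := one_sub_conj_mul_ne_zero ha hz
  have h2 := one_sub_conj_mul_ne_zero ha ha
  have h3 : 1 - conj a * z + conj a * (z - a) ≠ 0 := by convert h2 using 1; ring
  simp only [discAut, map_neg, sub_neg_eq_add, neg_mul]
  rw [div_add' _ _ _ h1, mul_div_assoc', one_add_div h1, div_div_div_cancel_right₀ h1, div_eq_iff h3]
  ring

theorem moebiusDist_comm (z w : ℂ) : moebiusDist z w = moebiusDist w z := by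
  simp only [moebiusDist, norm_div]
  rw [norm_sub_rev z w, ← RCLike.norm_conj (1 - conj w * z)]
  simp [mul_comm]

/-! ### The Schwarz lemma for the eigenvalues -/

section HolomorphicDiscMaps

variable {n : ℕ} {Ω : Set ℂ} {F : ℂ → Matrix (Fin n) (Fin n) ℂ}

/-- A function `h` on `Ω`, bounded by `1`, that vanishes on the eigenvalues of `F ζ₁` to the orders
prescribed by the minimal polynomial is bounded by `moebiusDist ζ₂ ζ₁` on those of `F ζ₂`. -/
theorem norm_le_moebiusDist_of_mem_spectrum (hΩ : IsOpen Ω)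
    (hF : IsHolomorphicDiscMap F (matricialDomain n Ω)) {ζ₁ ζ₂ : ℂ} (hζ₁ : ζ₁ ∈ ball (0 : ℂ) 1)
    (hζ₂ : ζ₂ ∈ ball (0 : ℂ) 1) {h : ℂ → ℂ} (hd : DifferentiableOn ℂ h Ω)
    (hb : ∀ z ∈ Ω, ‖h z‖ ≤ 1)
    (hh : ∀ l ∈ spectrum ℂ (F ζ₁), h =O[𝓝 l] fun z => (minpoly ℂ (F ζ₁)).eval z)
    {a : ℂ} (ha : a ∈ spectrum ℂ (F ζ₂)) : ‖h a‖ ≤ moebiusDist ζ₂ ζ₁ := by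
  rw [mem_ball_zero_iff] at hζ₁ hζ₂
  have hn : ‖-ζ₁‖ < 1 := by rwa [norm_neg]
  have hmaps : MapsTo (discAut (-ζ₁)) (ball 0 1) (ball 0 1) := fun z hz =>
    mem_ball_zero_iff.2 (norm_discAut_lt_one hn (mem_ball_zero_iff.1 hz))
  have h0 : discAut (-ζ₁) 0 = ζ₁ := by simp [discAut]
  rw [moebiusDist_eq_norm_discAut]
  refine norm_le_norm_of_mem_spectrum (F := fun w => F (discAut (-ζ₁) w))
    (fun i j => (hF.1 i j).comp (differentiableOn_discAut hn) hmaps) hΩ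
    (fun w hw => hF.2 (hmaps hw)) hd hb (by rwa [h0])
    (mem_ball_zero_iff.2 (norm_discAut_lt_one hζ₁ hζ₂)) ?_
  rwa [discAut_neg_discAut hζ₁ hζ₂]

/-! ### Products of Carathéodory distances -/

theorem minpoly_eval_eq_prod (A : Matrix (Fin n) (Fin n) ℂ) (z : ℂ) :
    (minpoly ℂ A).eval z =
      ∏ l ∈ eigenvalueFinset A, (z - l) ^ (minpoly ℂ A).rootMultiplicity l := by
  classical
  have hm : (minpoly ℂ A).Monic := minpoly.monic (Algebra.IsIntegral.isIntegral A)
  have hsub : (minpoly ℂ A).roots.toFinset ⊆ eigenvalueFinset A := by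
    intro l hl
    rw [Multiset.mem_toFinset, mem_roots hm.ne_zero] at hl
    rw [eigenvalueFinset, Set.Finite.mem_toFinset, Matrix.mem_spectrum_iff_isRoot_charpoly]
    exact hl.dvd A.minpoly_dvd_charpoly
  rw [(IsAlgClosed.splits (minpoly ℂ A)).eval_eq_prod_roots_of_monic hm,
    Finset.prod_multiset_map_count]
  simp only [count_roots]
  refine Finset.prod_subset hsub fun l _ hl => ?_
  rw [Multiset.mem_toFinset, ← Multiset.count_eq_zero, count_roots] at hl
  rw [hl, pow_zero]

/-- The bound for one choice of competitors `f l` in the Carathéodory distances. -/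
theorem prod_moebiusDist_le (hΩ : IsOpen Ω) (hF : IsHolomorphicDiscMap F (matricialDomain n Ω))
    {ζ₁ ζ₂ : ℂ} (hζ₁ : ζ₁ ∈ ball (0 : ℂ) 1) (hζ₂ : ζ₂ ∈ ball (0 : ℂ) 1) {f : ℂ → ℂ → ℂ}
    (hf : ∀ l ∈ eigenvalueFinset (F ζ₁), DifferentiableOn ℂ (f l) Ω ∧ MapsTo (f l) Ω (ball 0 1))
    {μ : ℂ} (hμ : μ ∈ eigenvalueFinset (F ζ₂)) :
    ∏ l ∈ eigenvalueFinset (F ζ₁),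
      moebiusDist (f l μ) (f l l) ^ (minpoly ℂ (F ζ₁)).rootMultiplicity l ≤ moebiusDist ζ₂ ζ₁ := by
  have hS : ∀ {ζ l}, l ∈ eigenvalueFinset (F ζ) ↔ l ∈ spectrum ℂ (F ζ) := by
    simp [eigenvalueFinset]
  have hlΩ : ∀ l ∈ eigenvalueFinset (F ζ₁), l ∈ Ω := fun l hl => hF.2 hζ₁ (hS.1 hl)
  have hfl : ∀ l ∈ eigenvalueFinset (F ζ₁), ∀ z ∈ Ω, ‖f l z‖ < 1 := fun l hl z hz =>
    mem_ball_zero_iff.1 ((hf l hl).2 hz)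
  have hdl : ∀ l ∈ eigenvalueFinset (F ζ₁),
      DifferentiableOn ℂ (fun z => discAut (f l l) (f l z)) Ω := fun l hl =>
    (differentiableOn_discAut (hfl l hl l (hlΩ l hl))).comp (hf l hl).1 (hf l hl).2
  set h : ℂ → ℂ := fun z => ∏ l ∈ eigenvalueFinset (F ζ₁),
    discAut (f l l) (f l z) ^ (minpoly ℂ (F ζ₁)).rootMultiplicity l with hh
  have hmain : ‖h μ‖ ≤ moebiusDist ζ₂ ζ₁ := by
    refine norm_le_moebiusDist_of_mem_spectrum hΩ hF hζ₁ hζ₂ ?_ ?_ ?_ (hS.1 hμ)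
    · exact DifferentiableOn.fun_finsetProd fun l hl => (hdl l hl).fun_pow _
    · intro z hz
      rw [hh, norm_prod]
      refine Finset.prod_le_one (fun _ _ => norm_nonneg _) fun l hl => ?_
      rw [norm_pow]
      exact pow_le_one₀ (norm_nonneg _)
        (norm_discAut_lt_one (hfl l hl l (hlΩ l hl)) (hfl l hl z hz)).le
    · intro l₀ hl₀
      have hl₀Ω := hF.2 hζ₁ hl₀
      simp only [minpoly_eval_eq_prod]
      refine Asymptotics.IsBigO.finsetProd fun l hl => Asymptotics.IsBigO.pow ?_ _
      have hdiff : DifferentiableAt ℂ (fun z => discAut (f l l) (f l z)) l₀ :=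
        (hdl l hl).differentiableAt (hΩ.mem_nhds hl₀Ω)
      rcases eq_or_ne l₀ l with rfl | hne
      · simpa [discAut] using hdiff.isBigO_sub
      · have hinv : ContinuousAt (fun z => (z - l)⁻¹) l₀ :=
          ContinuousAt.inv₀ (by fun_prop) (sub_ne_zero.2 hne)
        have hO := (hinv.isBigO_one ℂ).inv_rev <| by
          filter_upwards [isOpen_ne.mem_nhds hne] with z hz h
          exact absurd (inv_eq_zero.1 h) (sub_ne_zero.2 hz)
        simp only [inv_one, inv_inv] at hO
        exact (hdiff.continuousAt.isBigO_one ℂ).trans hO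
  rw [hh, norm_prod] at hmain
  simpa only [norm_pow, ← moebiusDist_eq_norm_discAut] using hmain

theorem caratheodoryProd_le (hΩ : IsOpen Ω) (hF : IsHolomorphicDiscMap F (matricialDomain n Ω))
    {ζ₁ ζ₂ : ℂ} (hζ₁ : ζ₁ ∈ ball (0 : ℂ) 1) (hζ₂ : ζ₂ ∈ ball (0 : ℂ) 1)
    {μ : ℂ} (hμ : μ ∈ eigenvalueFinset (F ζ₂)) :
    caratheodoryProd Ω (F ζ₁) μ ≤ moebiusDist ζ₂ ζ₁ := by
  have hμΩ : μ ∈ Ω := hF.2 hζ₂ (by simpa [eigenvalueFinset] using hμ)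
  have hseq : ∀ l ∈ eigenvalueFinset (F ζ₁), ∃ f : ℕ → ℂ → ℂ,
      (∀ k, DifferentiableOn ℂ (f k) Ω ∧ MapsTo (f k) Ω (ball 0 1)) ∧
      Tendsto (fun k => moebiusDist (f k μ) (f k l)) atTop (𝓝 (caratheodoryDist Ω μ l)) := by
    intro l hl
    have hlΩ : l ∈ Ω := hF.2 hζ₁ (by simpa [eigenvalueFinset] using hl)
    obtain ⟨u, -, hu, hmem⟩ := exists_seq_tendsto_sSup
      (S := {r : ℝ | ∃ f : ℂ → ℂ, DifferentiableOn ℂ f Ω ∧ MapsTo f Ω (ball 0 1) ∧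
        r = moebiusDist (f μ) (f l)})
      ⟨_, fun _ => 0, differentiableOn_const 0, fun _ _ => by simp, rfl⟩
      ⟨1, by
        rintro _ ⟨f, -, hf, rfl⟩
        exact (norm_discAut_lt_one (mem_ball_zero_iff.1 (hf hlΩ))
          (mem_ball_zero_iff.1 (hf hμΩ))).le⟩
    choose f hfd hfm hfu using hmem
    exact ⟨f, fun k => ⟨hfd k, hfm k⟩, hu.congr hfu⟩
  choose! f hf hlim using hseq
  -- The suprema need not be attained, so the bound passes to the limit along maximizing sequences.
  refine le_of_tendsto' (tendsto_finsetProd _ fun l hl => (hlim l hl).pow _) fun k => ?_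
  exact prod_moebiusDist_le hΩ hF hζ₁ hζ₂ (f := fun l => f l k) (fun l hl => hf l hl k) hμ

end HolomorphicDiscMaps

theorem theorem1p7 (n : ℕ) (hn : 2 ≤ n)
    (Ω : Set ℂ) (hΩ_open : IsOpen Ω) (hΩ_conn : IsConnected Ω)
    (hΩ_hyp : IsCaratheodoryHyperbolic Ω)
    (F : ℂ → Matrix (Fin n) (Fin n) ℂ)
    (hF : IsHolomorphicDiscMap F (matricialDomain n Ω))
    (ζ₁ ζ₂ : ℂ) (hζ₁ : ζ₁ ∈ Metric.ball (0 : ℂ) 1) (hζ₂ : ζ₂ ∈ Metric.ball (0 : ℂ) 1)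
    (W₁ W₂ : Matrix (Fin n) (Fin n) ℂ) (hW₁ : W₁ = F ζ₁) (hW₂ : W₂ = F ζ₂) :
    max
      ((eigenvalueFinset W₂).sup' (eigenvalueFinset_nonempty hn W₂)
        (fun μ => caratheodoryProd Ω W₁ μ))
      ((eigenvalueFinset W₁).sup' (eigenvalueFinset_nonempty hn W₁)
        (fun l => caratheodoryProd Ω W₂ l))
      ≤ moebiusDist ζ₁ ζ₂ := by
  subst hW₁ hW₂
  refine max_le (Finset.sup'_le _ _ fun μ hμ => ?_) (Finset.sup'_le _ _ fun l hl => ?_)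
  · rw [moebiusDist_comm]
    exact caratheodoryProd_le hΩ_open hF hζ₁ hζ₂ hμ
  · exact caratheodoryProd_le hΩ_open hF hζ₂ hζ₁ hl
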